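/- Let $\mathbb X,\mathbb Y,\mathbb E$ be finite-dimensional Euclidean spaces, let $\Phi:\mathbb X\to\mathbb E$ and $K:\mathbb X\to\mathbb Y$ be linear operators, and let $g:\mathbb Y\to\mathbb R\cup\{+\infty\}$ be a lower semicontinuous convex piecewise linear-quadratic function; that is, $\operatorname{dom} g$ is a union of finitely many polyhedral sets, on each of which $g(y)=\tfrac12\langle Ay,y\rangle+\langle q,y\rangle+c$ for some symmetric positive semidefinite $A$, some $q\in\mathbb Y$ and some $c\in\mathbb R$. Suppose that $\operatorname{dom} g\cap\operatorname{Im}K\neq\emptyset$. For $b\in\mathbb E$ and $\mu>0$ consider the problem $$P(b,\mu):\qquad \min_{x\in\mathbb X}\ \frac1{2\mu}\|\Phi x-b\|^2+g(Kx)$$ and the solution mapping $$S_{LS}(b,\mu)=\Big\{x\in\mathbb X\ \Big|\ 0\in\frac1\mu\Phi^*(\Phi x-b)+K^*\partial g(Kx)\Big\},$$ where $\partial g$ is the subdifferential of convex analysis. Let $\bar b\in\mathbb E$, $\bar\mu>0$ and $\bar x\in\mathbb X$. Then the following are equivalent: 1. $S_{LS}$ is isolated calm at $(\bar b,\bar\mu)$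 for $\bar x$: $\bar x\in S_{LS}(\bar b,\bar\mu)$, and there are neighborhoods $U$ of $\bar x$, $V$ of $\bar b$, $W\subset(0,\infty)$ of $\bar\mu$ and a constant $\kappa>0$ such that $\|x-\bar x\|\le\kappa(\|b-\bar b\|+|\mu-\bar\mu|)$ for all $b\in V$, $\mu\in W$ and $x\in S_{LS}(b,\mu)\cap U$. 2. $S_{LS}(\bar b,\bar\mu)=\{\bar x\}$. 3. $\bar x$ is the unique solution (global minimizer) of $P(\bar b,\bar\mu)$. 4. $\bar x$ is a strong solution of $P(\bar b,\bar\mu)$: the objective $\psi$ of $P(\bar b,\bar\mu)$ is finite at $\bar x$, and there are $c,\varepsilon>0$ with $\psi(x)\ge\psi(\bar x)+\tfrac c2\|x-\bar x\|^2$ whenever $\|x-\bar x\|<\varepsilon$. -/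

import Mathlib

open scoped Topology

noncomputable section

namespace RegLS

section ConvexFunctions

variable {Y : Type*} [NormedAddCommGroup Y] [InnerProductSpace ℝ Y]

/-- The effective domain of an extended-real-valued function. -/
def effDomain (g : Y → EReal) : Set Y := {y | g y ≠ ⊤}

/-- Convexity of an extended-real-valued function: its epigraph is convex. -/
def IsConvexFun (g : Y → EReal) : Prop :=
  Convex ℝ {p : Y × ℝ | g p.1 ≤ (p.2 : EReal)}

/-- A polyhedral set: the solution set of finitely many affine inequalities. -/
def IsPolyhedral (C : Set Y) : Prop :=
  ∃ (m : ℕ) (a : Fin m → Y) (β : Fin m → ℝ), C = {y | ∀ i, inner ℝ (a i) y ≤ β i}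

/-- Piecewise linear-quadratic: the effective domain is a union of finitely many polyhedral sets,
on each of which the function is `½⟨Ay, y⟩ + ⟨q, y⟩ + c` with `A` symmetric positive
semidefinite. -/
def IsPiecewiseLinearQuadratic (g : Y → EReal) : Prop :=
  ∃ (N : ℕ) (C : Fin N → Set Y),
    (∀ i, IsPolyhedral (C i)) ∧ effDomain g = ⋃ i, C i ∧
    ∀ i, ∃ (A : Y →ₗ[ℝ] Y) (q : Y) (c : ℝ), A.IsPositive ∧
      ∀ y ∈ C i, g y = ((1 / 2 * inner ℝ (A y) y + inner ℝ q y + c : ℝ) : EReal)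

/-- The subdifferential of convex analysis (empty outside the effective domain). -/
def subdifferential (g : Y → EReal) (y : Y) : Set Y :=
  {v | y ∈ effDomain g ∧ ∀ u, g y + ((inner ℝ v (u - y) : ℝ) : EReal) ≤ g u}

end ConvexFunctions

section Problem

variable {X Y E : Type*}
  [NormedAddCommGroup X] [InnerProductSpace ℝ X] [FiniteDimensional ℝ X]
  [NormedAddCommGroup Y] [InnerProductSpace ℝ Y] [FiniteDimensional ℝ Y]
  [NormedAddCommGroup E] [InnerProductSpace ℝ E] [FiniteDimensional ℝ E]

/-- The objective `(1/(2μ)) ‖Φ x - b‖² + g (K x)` of the problem `P(b, μ)`. -/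
def objective (Φ : X →ₗ[ℝ] E) (K : X →ₗ[ℝ] Y) (g : Y → EReal) (b : E) (μ : ℝ) (x : X) : EReal :=
  ((1 / (2 * μ) * ‖Φ x - b‖ ^ 2 : ℝ) : EReal) + g (K x)

/-- The solution mapping
`S_LS(b, μ) = {x | 0 ∈ (1/μ) Φ*(Φ x - b) + K* ∂g(K x)}`. -/
def solutionMap (Φ : X →ₗ[ℝ] E) (K : X →ₗ[ℝ] Y) (g : Y → EReal) (b : E) (μ : ℝ) : Set X :=
  {x | ∃ y ∈ subdifferential g (K x),
    (1 / μ) • LinearMap.adjoint Φ (Φ x - b) + LinearMap.adjoint K y = 0}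

end Problem

section Solutions

variable {X E : Type*} [NormedAddCommGroup X] [NormedAddCommGroup E]

/-- `x̄` is the unique global minimizer of `ψ`. -/
def IsUniqueMinimizer (ψ : X → EReal) (xbar : X) : Prop :=
  ∀ x, (∀ z, ψ x ≤ ψ z) ↔ x = xbar

/-- `x̄` is a strong minimizer (of order two) of `ψ`: `ψ x̄` is finite and `ψ` grows at least
quadratically around `x̄`. -/
def IsStrongMinimizer (ψ : X → EReal) (xbar : X) : Prop :=
  ψ xbar ≠ ⊤ ∧ ψ xbar ≠ ⊥ ∧ ∃ c > (0 : ℝ), ∃ ε > (0 : ℝ), ∀ x ∈ Metric.ball xbar ε,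
    ψ xbar + ((c / 2 * ‖x - xbar‖ ^ 2 : ℝ) : EReal) ≤ ψ x

/-- Isolated calmness at `(b̄, μ̄) ∈ E × (0, ∞)` for `x̄ ∈ S(b̄, μ̄)` of a set-valued mapping `S`
defined on `E × (0, ∞)` (its values at `μ ≤ 0` are irrelevant). -/
def IsIsolatedCalm (S : E → ℝ → Set X) (bbar : E) (μbar : ℝ) (xbar : X) : Prop :=
  xbar ∈ S bbar μbar ∧
  ∃ U ∈ 𝓝 xbar, ∃ V ∈ 𝓝 bbar, ∃ W ∈ 𝓝 μbar, W ⊆ Set.Ioi 0 ∧ ∃ κ > (0 : ℝ),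
    ∀ b ∈ V, ∀ μ ∈ W, ∀ x ∈ S b μ ∩ U, ‖x - xbar‖ ≤ κ * (‖b - bbar‖ + |μ - μbar|)

end Solutions

end RegLS

end

open scoped Topology
open Module

/-! Two facts carry the equivalence. (a) Solutions of the generalized equation are the global
minimizers (`mem_solutionMap_iff`). One inclusion is the subgradient inequality. The other needs a
subgradient of `g` at `K x` with prescribed values on the range of `K`, although that range may only
touch the boundary of `dom g`. It comes from separating (0, -1) from the cone generated by the
difference quotients of `g` plus the graph of `(K, p)`. This cone lies in a finite union of closed
sets missing (0, -1), one per piece containing the base point: each is a polyhedral cone plus a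
subspace, hence polyhedral by Fourier–Motzkin elimination. This yields
`exists_mem_subdifferential_inner_comp_eq`. (b) A unique minimizer is strong. On each polyhedral
piece the objective equals its second-order expansion, with first-order part `d` and second-order
part `B ≥ 0`. Uniqueness forces `d + B > 0` on nonzero tangent directions, and compactness of the
unit sphere makes this uniform (`exists_growth_of_piece`). Isolated calmness at the unperturbed
parameters isolates the minimizer, so convexity along segments makes it unique. Conversely,
quadratic growth added to the subgradient inequality at a perturbed solution bounds the squared
distance by the distance times the perturbation. -/

namespace RegLS

/-! ### Polyhedral cones and Fourier–Motzkin elimination. -/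

section PolyhedralCones

variable {V : Type*} [AddCommGroup V] [Module ℝ V]

/-- A polyhedral cone: the solution set of finitely many homogeneous linear inequalities. -/
def IsPolyhedralCone (S : Set V) : Prop :=
  ∃ s : Finset (Dual ℝ V), S = {v | ∀ f ∈ s, f v ≤ 0}

/-- Supplies the value of the variable eliminated in Fourier–Motzkin. Either family of bounds may be
empty. -/
theorem exists_le_forall_le_of_finset {ι κ : Type*} (s : Finset ι) (t : Finset κ) (l : ι → ℝ)
    (u : κ → ℝ) (h : ∀ i ∈ s, ∀ j ∈ t, l i ≤ u j) :
    ∃ r : ℝ, (∀ i ∈ s, l i ≤ r) ∧ ∀ j ∈ t, r ≤ u j := by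
  rcases s.eq_empty_or_nonempty with rfl | hs
  · rcases t.eq_empty_or_nonempty with rfl | ht
    · exact ⟨0, by simp, by simp⟩
    · exact ⟨t.inf' ht u, by simp, fun j hj => Finset.inf'_le _ hj⟩
  · exact ⟨s.sup' hs l, fun i hi => Finset.le_sup' l hi,
      fun j hj => Finset.sup'_le hs l fun i hi => h i hi j hj⟩

/-- Fourier–Motzkin elimination of one direction. -/
theorem IsPolyhedralCone.add_line {S : Set V} (hS : IsPolyhedralCone S) (e : V) :
    IsPolyhedralCone {v | ∃ t : ℝ, v + t • e ∈ S} := by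
  classical
  obtain ⟨s, rfl⟩ := hS
  -- Constraints with `f e = 0` do not see `t`. The others bound `t` below or above according to the
  -- sign of `f e`, and each opposite pair gives the nonnegative combination in which `e` cancels.
  refine ⟨s.filter (fun f => f e = 0) ∪
    ((s.filter fun f => f e < 0) ×ˢ (s.filter fun f => 0 < f e)).image
      (fun q => q.2 e • q.1 - q.1 e • q.2), ?_⟩
  ext v
  constructor
  · rintro ⟨t, ht⟩ f hf
    simp only [Finset.mem_union, Finset.mem_filter, Finset.mem_image, Finset.mem_product,
      Prod.exists] at hf
    rcases hf with ⟨hf, he⟩ | ⟨f₁, f₂, ⟨⟨h₁, e₁⟩, h₂, e₂⟩, rfl⟩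
    · simpa [he] using ht f hf
    · have k₁ := ht f₁ h₁
      have k₂ := ht f₂ h₂
      simp only [map_add, map_smul, smul_eq_mul, LinearMap.sub_apply, LinearMap.smul_apply]
        at k₁ k₂ ⊢
      nlinarith [mul_nonneg e₂.le (sub_nonneg.2 k₁), mul_nonneg (neg_pos.2 e₁).le (sub_nonneg.2 k₂)]
  · intro hv
    obtain ⟨r, hl, hu⟩ := exists_le_forall_le_of_finset (s.filter fun f => f e < 0)
      (s.filter fun f => 0 < f e) (fun f => -f v / f e) (fun f => -f v / f e) (by
        intro f₁ h₁ f₂ h₂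
        have := hv (f₂ e • f₁ - f₁ e • f₂) (Finset.mem_union_right _ (Finset.mem_image.2
          ⟨(f₁, f₂), Finset.mem_product.2 ⟨h₁, h₂⟩, rfl⟩))
        have e₁ := (Finset.mem_filter.1 h₁).2
        have e₂ := (Finset.mem_filter.1 h₂).2
        simp only [smul_eq_mul, LinearMap.sub_apply, LinearMap.smul_apply] at this
        rw [le_div_iff₀ e₂, div_mul_eq_mul_div, div_le_iff_of_neg e₁]
        linarith)
    refine ⟨r, fun f hf => ?_⟩
    simp only [map_add, map_smul, smul_eq_mul]
    rcases lt_trichotomy (f e) 0 with h | h | h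
    · have := hl f (Finset.mem_filter.2 ⟨hf, h⟩)
      rw [div_le_iff_of_neg h] at this
      linarith
    · have := hv f (Finset.mem_union_left _ (Finset.mem_filter.2 ⟨hf, h⟩))
      simpa [h] using this
    · have := hu f (Finset.mem_filter.2 ⟨hf, h⟩)
      rw [le_div_iff₀ h] at this
      linarith

/-- The set is the sum `S + M`. A finitely generated `M` is a sum of lines, which are eliminated one
at a time. -/
theorem IsPolyhedralCone.add_submodule {S : Set V} (hS : IsPolyhedralCone S) {M : Submodule ℝ V}
    (hM : M.FG) : IsPolyhedralCone {v | ∃ m ∈ M, v + m ∈ S} := by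
  induction M, hM using Submodule.fg_induction generalizing S with
  | singleton e =>
    convert hS.add_line e using 3 with v
    simp [Submodule.mem_span_singleton]
  | sup M₁ M₂ _ _ h₁ h₂ =>
    convert h₂ (h₁ hS) using 3 with v
    constructor
    · rintro ⟨m, hm, hv⟩
      obtain ⟨a, ha, b, hb, rfl⟩ := Submodule.mem_sup.1 hm
      exact ⟨b, hb, a, ha, by rwa [add_assoc, add_comm b a]⟩
    · rintro ⟨b, hb, a, ha, hv⟩
      exact ⟨b + a, add_mem (Submodule.mem_sup_right hb) (Submodule.mem_sup_left ha),
        by rwa [← add_assoc]⟩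

end PolyhedralCones

/-- Combined with `add_submodule`, this makes a polyhedral cone plus a subspace closed, which fails
for general closed convex cones. -/
theorem IsPolyhedralCone.isClosed {V : Type*} [NormedAddCommGroup V] [NormedSpace ℝ V]
    [FiniteDimensional ℝ V] {S : Set V} (hS : IsPolyhedralCone S) : IsClosed S := by
  obtain ⟨s, rfl⟩ := hS
  simp only [Set.ofPred_forall]
  exact isClosed_biInter fun f _ =>
    isClosed_le (LinearMap.continuous_of_finiteDimensional f) continuous_const

/-! ### Local conical structure of polyhedral sets. -/

section Polyhedral

variable {Y : Type*} [NormedAddCommGroup Y] [InnerProductSpace ℝ Y]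

theorem IsPolyhedral.isClosed {C : Set Y} (hC : IsPolyhedral C) : IsClosed C := by
  obtain ⟨m, a, β, rfl⟩ := hC
  simp only [Set.ofPred_forall]
  exact isClosed_iInter fun i => isClosed_le (by fun_prop) continuous_const

/-- Only the constraints active at `y` matter near `y`: the finitely many inactive ones have
positive slack, which survives displacements of a uniform size `δ`. -/
theorem IsPolyhedral.exists_tangentCone {C : Set Y} (hC : IsPolyhedral C) {y : Y} (hy : y ∈ C) :
    ∃ s : Finset (Dual ℝ Y), (∀ w, y + w ∈ C → ∀ f ∈ s, f w ≤ 0) ∧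
      ∃ δ > (0 : ℝ), ∀ w, (∀ f ∈ s, f w ≤ 0) → ‖w‖ ≤ δ → y + w ∈ C := by
  classical
  obtain ⟨m, a, β, rfl⟩ := hC
  refine ⟨(Finset.univ.filter fun i => inner ℝ (a i) y = β i).image
    (fun i => innerₗ Y (a i)), ?_, ?_⟩
  · intro w hw f hf
    simp only [Finset.mem_image, Finset.mem_filter, Finset.mem_univ, true_and] at hf
    obtain ⟨i, hi, rfl⟩ := hf
    have := hw i
    rw [inner_add_right] at this
    simp only [innerₗ_apply_apply]
    linarith
  · have key : ∀ i, ∃ δ > (0 : ℝ), ∀ w, (inner ℝ (a i) y = β i → inner ℝ (a i) w ≤ 0) →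
        ‖w‖ ≤ δ → inner ℝ (a i) (y + w) ≤ β i := by
      intro i
      by_cases h : inner ℝ (a i) y = β i
      · refine ⟨1, one_pos, fun w hw _ => ?_⟩
        rw [inner_add_right]
        linarith [hw h]
      -- The radius is the slack over the norm of the normal; the added 1 covers a zero normal.
      · have hlt : 0 < β i - inner ℝ (a i) y := sub_pos.2 (lt_of_le_of_ne (hy i) h)
        refine ⟨(β i - inner ℝ (a i) y) / (‖a i‖ + 1), by positivity, fun w _ hw => ?_⟩
        rw [le_div_iff₀ (by positivity)] at hw
        rw [inner_add_right]
        nlinarith [real_inner_le_norm (a i) w, norm_nonneg w]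
    choose δ hδ hk using key
    obtain ⟨r, hr0, hr⟩ : ∃ r > (0 : ℝ), ∀ i, r ≤ δ i := by
      rcases isEmpty_or_nonempty (Fin m) with hm | hm
      · exact ⟨1, one_pos, fun i => hm.elim i⟩
      · obtain ⟨i, hi⟩ := Finite.exists_min δ
        exact ⟨δ i, hδ i, hi⟩
    refine ⟨r, hr0, fun w hw hwr i => hk i w (fun h => ?_) (hwr.trans (hr i))⟩
    exact hw _ (Finset.mem_image.2 ⟨i, by simpa using h, rfl⟩)

end Polyhedral

/-! ### Real-valued calculus on the effective domain. -/

section RealValues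

variable {Y : Type*} {g : Y → EReal}

theorem coe_toReal_of_mem_effDomain (hbot : ∀ y, g y ≠ ⊥) {y : Y} (hy : y ∈ effDomain g) :
    ((g y).toReal : EReal) = g y :=
  EReal.coe_toReal hy (hbot y)

variable [NormedAddCommGroup Y] [InnerProductSpace ℝ Y]

theorem IsConvexFun.toReal_le (hconv : IsConvexFun g) (hbot : ∀ y, g y ≠ ⊥) {y z : Y}
    (hy : y ∈ effDomain g) (hz : z ∈ effDomain g) {a b : ℝ} (ha : 0 ≤ a) (hb : 0 ≤ b)
    (hab : a + b = 1) :
    a • y + b • z ∈ effDomain g ∧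
      (g (a • y + b • z)).toReal ≤ a * (g y).toReal + b * (g z).toReal := by
  have h := hconv (x := (y, (g y).toReal)) (coe_toReal_of_mem_effDomain hbot hy).ge
    (y := (z, (g z).toReal)) (coe_toReal_of_mem_effDomain hbot hz).ge ha hb hab
  have h' : g (a • y + b • z) ≤ ((a * (g y).toReal + b * (g z).toReal : ℝ) : EReal) := h
  have hm : a • y + b • z ∈ effDomain g := ne_top_of_le_ne_top (EReal.coe_ne_top _) h'
  refine ⟨hm, ?_⟩
  rwa [← coe_toReal_of_mem_effDomain hbot hm, EReal.coe_le_coe_iff] at h'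

theorem mem_subdifferential_iff (hbot : ∀ y, g y ≠ ⊥) {y v : Y} :
    v ∈ subdifferential g y ↔ y ∈ effDomain g ∧
      ∀ u ∈ effDomain g, (g y).toReal + inner ℝ v (u - y) ≤ (g u).toReal := by
  refine and_congr_right fun hy => forall_congr' fun u => ?_
  rw [← coe_toReal_of_mem_effDomain hbot hy, ← EReal.coe_add, EReal.toReal_coe]
  constructor
  · intro h hu
    rwa [← coe_toReal_of_mem_effDomain hbot hu, EReal.coe_le_coe_iff] at h
  · intro h
    by_cases hu : u ∈ effDomain g
    · rw [← coe_toReal_of_mem_effDomain hbot hu, EReal.coe_le_coe_iff]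
      exact h hu
    · rw [not_not.1 hu]
      exact le_top

/-- A quadratic equals its second-order Taylor expansion; symmetry of `A` merges the two cross
terms. -/
theorem toReal_add_eq {C : Set Y} {A : Y →ₗ[ℝ] Y} {q : Y} {c : ℝ} (hA : A.IsPositive)
    (hg : ∀ y ∈ C, g y = ((1 / 2 * inner ℝ (A y) y + inner ℝ q y + c : ℝ) : EReal)) {y w : Y}
    (hy : y ∈ C) (hw : y + w ∈ C) :
    (g (y + w)).toReal =
      (g y).toReal + inner ℝ (A y + q) w + 1 / 2 * inner ℝ (A w) w := by
  rw [hg _ hy, hg _ hw, EReal.toReal_coe, EReal.toReal_coe, map_add]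
  simp only [inner_add_left, inner_add_right]
  have : inner ℝ (A w) y = inner ℝ (A y) w := by
    rw [hA.isSymmetric w y, real_inner_comm]
  rw [this]
  ring

theorem nonneg_of_forall_small {x y δ : ℝ} (hδ : 0 < δ)
    (h : ∀ t, 0 < t → t ≤ δ → 0 ≤ x + t * y) : 0 ≤ x := by
  by_contra! hx
  have h₀ : 0 < min δ (-x / (|y| + 1) / 2) :=
    lt_min hδ (by have := neg_pos.2 hx; positivity)
  have h₁ := h _ h₀ (min_le_left _ _)
  have h₂ := min_le_right δ (-x / (|y| + 1) / 2)
  set t := min δ (-x / (|y| + 1) / 2)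
  rw [le_div_iff₀ two_pos, le_div_iff₀ (by positivity)] at h₂
  nlinarith [le_abs_self y]

/-- Slopes of a convex function along a ray are nondecreasing. -/
theorem IsConvexFun.slope_mono (hconv : IsConvexFun g) (hbot : ∀ y, g y ≠ ⊥) {y w : Y}
    (hy : y ∈ effDomain g) {α s t : ℝ} (hs : 0 < s) (hst : s ≤ t)
    (hmem : y + t • w ∈ effDomain g) (hle : (g (y + t • w)).toReal ≤ (g y).toReal + t * α) :
    y + s • w ∈ effDomain g ∧ (g (y + s • w)).toReal ≤ (g y).toReal + s * α := by
  have ht : 0 < t := hs.trans_le hst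
  have hst' : s / t ≤ 1 := (div_le_one ht).2 hst
  obtain ⟨h₁, h₂⟩ := hconv.toReal_le hbot hy hmem (a := 1 - s / t) (b := s / t)
    (by linarith) (by positivity) (by ring)
  have e : (1 - s / t) • y + (s / t) • (y + t • w) = y + s • w := by
    rw [smul_add, smul_smul, div_mul_cancel₀ _ ht.ne']
    module
  rw [e] at h₁ h₂
  refine ⟨h₁, h₂.trans ?_⟩
  have : s / t * (g (y + t • w)).toReal ≤ s / t * ((g y).toReal + t * α) :=
    mul_le_mul_of_nonneg_left hle (by positivity)
  have e' : s / t * (t * α) = s * α := by field_simp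
  linarith

end RealValues

/-! ### The chain rule by separation. -/

section ChainRule

variable {X Y : Type*} [NormedAddCommGroup X] [InnerProductSpace ℝ X]
  [NormedAddCommGroup Y] [InnerProductSpace ℝ Y] [FiniteDimensional ℝ Y] {g : Y → EReal}

/-- The slopes of one linear-quadratic piece at `y`, added to the graph of `(K, p)`, are contained
in a closed set that misses `(0, -1)` if `p` is a first-order lower bound along `K`. -/
theorem exists_isClosed_of_piece {C : Set Y} (hC : IsPolyhedral C) {A : Y →ₗ[ℝ] Y} {q : Y} {c : ℝ}
    (hA : A.IsPositive)
    (hg : ∀ y ∈ C, g y = ((1 / 2 * inner ℝ (A y) y + inner ℝ q y + c : ℝ) : EReal))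
    {y : Y} (hy : y ∈ C) (K : X →ₗ[ℝ] Y) (p : X →ₗ[ℝ] ℝ) (r : X → ℝ)
    (hp : ∀ (h : X) (t : ℝ), 0 < t → y + t • K h ∈ C →
      (g y).toReal + t * p h - t ^ 2 * r h ≤ (g (y + t • K h)).toReal) :
    ∃ D : Set (Y × ℝ), IsClosed D ∧ ((0, -1) : Y × ℝ) ∉ D ∧
      ∀ (w : Y) (α : ℝ) (h : X),
        (∃ t > 0, y + t • w ∈ C ∧ (g (y + t • w)).toReal ≤ (g y).toReal + t * α) →
        (w + K h, α + p h) ∈ D := by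
  classical
  obtain ⟨s, hs, δ, hδ, hsδ⟩ := hC.exists_tangentCone hy
  -- `P` is the epigraph of the directional derivative of the piece, restricted to its tangent cone.
  -- `D` will be `P` plus the graph of `(K, p)`.
  let L : Dual ℝ (Y × ℝ) :=
    (innerₗ Y (A y + q)).comp (LinearMap.fst ℝ Y ℝ) - LinearMap.snd ℝ Y ℝ
  let P : Set (Y × ℝ) :=
    {z | ∀ f ∈ insert L (s.image fun f => f.comp (LinearMap.fst ℝ Y ℝ)), f z ≤ 0}
  have hP : IsPolyhedralCone P := ⟨_, rfl⟩
  have memP : ∀ w α, (w, α) ∈ P ↔ inner ℝ (A y + q) w ≤ α ∧ ∀ f ∈ s, f w ≤ 0 := by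
    intro w α
    simp [P, L, inner_add_left]
  let M : Submodule ℝ (Y × ℝ) := LinearMap.range (K.prod p)
  refine ⟨{v | ∃ m ∈ M, v + m ∈ P}, (hP.add_submodule (IsNoetherian.noetherian M)).isClosed,
    ?_, ?_⟩
  -- Membership would give a tangent direction `K h` with derivative at most `p h - 1`. Dividing the
  -- hypothesis on `p` by `t` and letting `t → 0` gives derivative at least `p h`, the remainder `r`
  -- being of second order.
  · rintro ⟨_, ⟨h, rfl⟩, hm⟩
    have e : ((0, -1) : Y × ℝ) + K.prod p h = (K h, -1 + p h) := by ext <;> simp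
    rw [e, memP] at hm
    have : 0 ≤ inner ℝ (A y + q) (K h) - p h := by
      refine nonneg_of_forall_small (δ := δ / (‖K h‖ + 1))
        (y := 1 / 2 * inner ℝ (A (K h)) (K h) + r h) (by positivity) fun t ht htδ => ?_
      rw [le_div_iff₀ (by positivity)] at htδ
      have hmem : y + t • K h ∈ C := by
        refine hsδ _ (fun f hf => ?_) ?_
        · rw [map_smul, smul_eq_mul]
          exact mul_nonpos_of_nonneg_of_nonpos ht.le (hm.2 f hf)
        · rw [norm_smul, Real.norm_of_nonneg ht.le]
          linarith
      have h₁ := hp h t ht hmem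
      rw [toReal_add_eq hA hg hy hmem, map_smul, inner_smul_left, inner_smul_right,
        inner_smul_right] at h₁
      simp only [RCLike.conj_to_real] at h₁
      refine le_of_mul_le_mul_left ?_ ht
      linarith
    linarith [hm.1]
  · rintro w α h ⟨t, ht, hmem, hle⟩
    refine ⟨-(K h, p h), neg_mem ⟨h, rfl⟩, ?_⟩
    rw [Prod.neg_mk, Prod.mk_add_mk, add_neg_cancel_right, add_neg_cancel_right, memP]
    rw [toReal_add_eq hA hg hy hmem, map_smul, inner_smul_left, inner_smul_right,
        inner_smul_right] at hle
    simp only [RCLike.conj_to_real] at hle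
    -- Because `A` is positive, the derivative at `y` is at most any difference quotient.
    have hpos : 0 ≤ inner ℝ (A w) w := hA.re_inner_nonneg_left w
    constructor
    · have : t * inner ℝ (A y + q) w ≤ t * α := by
        nlinarith [mul_nonneg (mul_nonneg ht.le ht.le) hpos]
      exact le_of_mul_le_mul_left this ht
    · intro f hf
      have := hs _ hmem f hf
      rw [map_smul, smul_eq_mul] at this
      exact nonpos_of_mul_nonpos_right this ht

open Filter in
/-- The chain rule for convex piecewise linear-quadratic functions, which needs no constraint
qualification. -/
theorem exists_mem_subdifferential_inner_comp_eq (hbot : ∀ y, g y ≠ ⊥) (hconv : IsConvexFun g)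
    (hplq : IsPiecewiseLinearQuadratic g) {y : Y} (hy : y ∈ effDomain g) (K : X →ₗ[ℝ] Y)
    (p : X →ₗ[ℝ] ℝ) (r : X → ℝ)
    (hp : ∀ (h : X) (t : ℝ), 0 < t → y + t • K h ∈ effDomain g →
      (g y).toReal + t * p h - t ^ 2 * r h ≤ (g (y + t • K h)).toReal) :
    ∃ v ∈ subdifferential g y, ∀ h, inner ℝ v (K h) = p h := by
  obtain ⟨N, C, hC, hdom, hquad⟩ := hplq
  have hsub : ∀ i, C i ⊆ effDomain g := fun i => hdom ▸ Set.subset_iUnion C i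
  have hpiece : ∀ i, ∃ D : Set (Y × ℝ), IsClosed D ∧ ((0, -1) : Y × ℝ) ∉ D ∧
      (y ∈ C i → ∀ (w : Y) (α : ℝ) (h : X),
        (∃ t > 0, y + t • w ∈ C i ∧ (g (y + t • w)).toReal ≤ (g y).toReal + t * α) →
        (w + K h, α + p h) ∈ D) := by
    intro i
    by_cases hi : y ∈ C i
    · obtain ⟨A, q, c, hA, hg⟩ := hquad i
      obtain ⟨D, h₁, h₂, h₃⟩ := exists_isClosed_of_piece (hC i) hA hg hi K p r
        (fun h t ht hm => hp h t ht (hsub i hm))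
      exact ⟨D, h₁, h₂, fun _ => h₃⟩
    · exact ⟨∅, isClosed_empty, by simp, fun h => absurd h hi⟩
  choose D hDc hDn hD using hpiece
  let S : Set (Y × ℝ) := {z | ∃ h : X, ∃ t > (0 : ℝ), y + t • (z.1 - K h) ∈ effDomain g ∧
    (g (y + t • (z.1 - K h))).toReal ≤ (g y).toReal + t * (z.2 - p h)}
  -- Slopes do not increase as the step shrinks. Along the ray some piece is met at arbitrarily
  -- small steps, since there are finitely many; being closed, it contains `y`.
  have hSD : S ⊆ ⋃ i, D i := by
    rintro ⟨w, α⟩ ⟨h, t, ht, hm, hle⟩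
    have hev : ∀ᶠ s in 𝓝[>] (0 : ℝ), ∃ i, y + s • (w - K h) ∈ C i := by
      filter_upwards [Ioc_mem_nhdsGT ht] with s hs
      have := (hconv.slope_mono hbot hy hs.1 hs.2 hm hle).1
      rw [hdom] at this
      exact Set.mem_iUnion.1 this
    obtain ⟨i, hi⟩ : ∃ i, ∃ᶠ s in 𝓝[>] (0 : ℝ), y + s • (w - K h) ∈ C i := by
      by_contra! hcon
      obtain ⟨s, ⟨i, hi⟩, hs⟩ := (hev.and (eventually_all.2 hcon)).exists
      exact hs i hi
    have hyi : y ∈ C i := by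
      have hlim : Tendsto (fun s : ℝ => y + s • (w - K h)) (𝓝[>] 0) (𝓝 y) := by
        have : Continuous fun s : ℝ => y + s • (w - K h) := by fun_prop
        simpa using (this.tendsto 0).mono_left nhdsWithin_le_nhds
      exact (hC i).isClosed.mem_of_frequently_of_tendsto hi hlim
    obtain ⟨s, hsC, hs⟩ := (hi.and_eventually (Ioc_mem_nhdsGT ht)).exists
    have := hD i hyi (w - K h) (α - p h) h
      ⟨s, hs.1, hsC, (hconv.slope_mono hbot hy hs.1 hs.2 hm hle).2⟩
    rw [sub_add_cancel, sub_add_cancel] at this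
    exact Set.mem_iUnion.2 ⟨i, this⟩
  have hn : ((0, -1) : Y × ℝ) ∉ closure S := by
    intro hmem
    have := closure_minimal hSD (isClosed_iUnion_of_finite hDc) hmem
    obtain ⟨i, hi⟩ := Set.mem_iUnion.1 this
    exact hDn i hi
  have hconvS : Convex ℝ S := by
    rintro ⟨w₁, α₁⟩ ⟨h₁, t₁, ht₁, hm₁, hle₁⟩ ⟨w₂, α₂⟩ ⟨h₂, t₂, ht₂, hm₂, hle₂⟩ a b ha hb hab
    -- Slope monotonicity brings both quotients to a common step, where convexity of `g` applies.
    have ht : 0 < min t₁ t₂ := lt_min ht₁ ht₂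
    obtain ⟨k₁, l₁⟩ := hconv.slope_mono hbot hy ht (min_le_left _ _) hm₁ hle₁
    obtain ⟨k₂, l₂⟩ := hconv.slope_mono hbot hy ht (min_le_right _ _) hm₂ hle₂
    obtain ⟨k, l⟩ := hconv.toReal_le hbot k₁ k₂ ha hb hab
    refine ⟨a • h₁ + b • h₂, min t₁ t₂, ht, ?_⟩
    set t := min t₁ t₂
    have e : y + t • ((a • ((w₁, α₁) : Y × ℝ) + b • (w₂, α₂)).1 - K (a • h₁ + b • h₂)) =
        a • (y + t • (w₁ - K h₁)) + b • (y + t • (w₂ - K h₂)) := by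
      obtain rfl : b = 1 - a := by linarith
      change y + t • (a • w₁ + (1 - a) • w₂ - K _) = _
      simp only [map_add, map_smul]
      module
    rw [e]
    refine ⟨k, l.trans ?_⟩
    obtain rfl : b = 1 - a := by linarith
    simp only [Prod.snd_add, Prod.smul_snd, smul_eq_mul, map_add, map_smul]
    nlinarith [mul_le_mul_of_nonneg_left l₁ ha, mul_le_mul_of_nonneg_left l₂ hb]
  have hmemS : ∀ (w : Y) (α : ℝ) (h : X) (t : ℝ), 0 < t → y + t • w ∈ effDomain g →
      (g (y + t • w)).toReal ≤ (g y).toReal + t * α → (w + K h, α + p h) ∈ S := by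
    intro w α h t ht hm hle
    exact ⟨h, t, ht, by simpa using hm, by simpa using hle⟩
  have hzeroS : ∀ h, (K h, p h) ∈ S := fun h => by
    simpa using hmemS 0 0 h 1 one_pos (by simpa using hy) (by simp)
  have hcone : ∀ z ∈ S, ∀ l : ℝ, 0 < l → l • z ∈ S := by
    rintro ⟨w, α⟩ ⟨h, t, ht, hm, hle⟩ l hl
    have e : (t / l) • (l • w - K (l • h)) = t • (w - K h) := by
      rw [map_smul, ← smul_sub, smul_smul, div_mul_cancel₀ _ hl.ne']
    refine ⟨l • h, t / l, by positivity, ?_⟩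
    simp only [Prod.smul_mk, e]
    refine ⟨hm, hle.trans_eq ?_⟩
    rw [map_smul, smul_eq_mul, smul_eq_mul, ← mul_sub, ← mul_assoc, div_mul_cancel₀ _ hl.ne']
  obtain ⟨f, u, hfu, hf⟩ :=
    geometric_hahn_banach_point_closed hconvS.closure isClosed_closure hn
  have hf' : ∀ z ∈ S, u < f z := fun z hz => hf z (subset_closure hz)
  have hu : u < 0 := by
    have := hf' _ (hzeroS 0)
    rwa [map_zero, map_zero, Prod.mk_zero_zero, map_zero] at this
  -- If `f z < 0`, scaling `z` by `u / f z` stays in the cone and gives `f` the forbidden value `u`.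
  have hnonneg : ∀ z ∈ S, 0 ≤ f z := by
    intro z hz
    by_contra! hlt
    have := hf' _ (hcone z hz (u / f z) (div_pos_of_neg_of_neg hu hlt))
    rw [map_smul, smul_eq_mul, div_mul_cancel₀ _ hlt.ne] at this
    exact lt_irrefl _ this
  have hsplit : ∀ w α, f (w, α) = f (w, 0) + α * f (0, 1) := by
    intro w α
    rw [← smul_eq_mul, ← map_smul, ← map_add]
    simp
  set σ := f (0, 1) with hσ
  -- The separated point being (0, -1), `f (0, -1) < u < 0`: the hyperplane is not vertical, so `f`
  -- can be normalized to read off `v`.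
  have hσ0 : 0 < σ := by
    have := hsplit 0 (-1)
    have h0 : f ((0 : Y), (0 : ℝ)) = 0 := map_zero f
    linarith
  let v : Y := (InnerProductSpace.toDual ℝ Y).symm
    ((-σ⁻¹) • f.comp (ContinuousLinearMap.inl ℝ Y ℝ))
  have hv : ∀ w α, f (w, α) = σ * (α - inner ℝ v w) := by
    intro w α
    have : inner ℝ v w = -σ⁻¹ * f (w, 0) := by
      simp [v, inner_smul_left]
    rw [this, hsplit]
    field_simp
    ring
  have hslope : ∀ w α, (w, α) ∈ S → inner ℝ v w ≤ α := by
    intro w α hw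
    have := hnonneg _ hw
    rw [hv] at this
    exact sub_nonneg.1 (nonneg_of_mul_nonneg_right this hσ0)
  refine ⟨v, (mem_subdifferential_iff hbot).2 ⟨hy, fun z hz => ?_⟩, fun h => ?_⟩
  · have := hslope (z - y) ((g z).toReal - (g y).toReal) (by
      simpa using hmemS (z - y) ((g z).toReal - (g y).toReal) 0 1 one_pos (by simpa using hz)
        (by simp))
    linarith
  -- The graph of `(K, p)` is a subspace inside `S`, so using `h` and `-h` turns the inequality into
  -- equality.
  · have h₁ := hslope _ _ (hzeroS h)
    have h₂ := hslope _ _ (hzeroS (-h))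
    rw [map_neg, map_neg, inner_neg_right] at h₂
    linarith

end ChainRule

theorem exists_pos_le_of_compact {V : Type*} [TopologicalSpace V] {S : Set V} (hS : IsCompact S)
    {f : V → ℝ} (hf : ContinuousOn f S) (hpos : ∀ x ∈ S, 0 < f x) :
    ∃ m > 0, ∀ x ∈ S, m ≤ f x := by
  rcases S.eq_empty_or_nonempty with rfl | hne
  · exact ⟨1, one_pos, by simp⟩
  · obtain ⟨x, hx, hmin⟩ := hS.exists_isMinOn hne hf
    exact ⟨f x, hpos x hx, fun y hy => hmin hy⟩

/-! ### The objective and its minimizers. -/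

section Problem

variable {X Y E : Type*}
  [NormedAddCommGroup X] [InnerProductSpace ℝ X]
  [NormedAddCommGroup Y] [InnerProductSpace ℝ Y]
  [NormedAddCommGroup E] [InnerProductSpace ℝ E]
  {Φ : X →ₗ[ℝ] E} {K : X →ₗ[ℝ] Y} {g : Y → EReal} {b : E} {μ : ℝ}

/-- The objective, as a real number, at points of its effective domain. -/
noncomputable def realObjective (Φ : X →ₗ[ℝ] E) (K : X →ₗ[ℝ] Y) (g : Y → EReal) (b : E) (μ : ℝ) (x : X) : ℝ :=
  1 / (2 * μ) * ‖Φ x - b‖ ^ 2 + (g (K x)).toReal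

theorem objective_eq_coe (hbot : ∀ y, g y ≠ ⊥) {x : X} (hx : K x ∈ effDomain g) :
    objective Φ K g b μ x = (realObjective Φ K g b μ x : EReal) := by
  rw [objective, realObjective, EReal.coe_add, coe_toReal_of_mem_effDomain hbot hx]

theorem objective_eq_top {x : X} (hx : K x ∉ effDomain g) : objective Φ K g b μ x = ⊤ := by
  rw [objective, not_not.1 hx, EReal.coe_add_top]

theorem le_objective_iff (hbot : ∀ y, g y ≠ ⊥) {x : X} {a : ℝ} :
    (a : EReal) ≤ objective Φ K g b μ x ↔
      (K x ∈ effDomain g → a ≤ realObjective Φ K g b μ x) := by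
  by_cases hx : K x ∈ effDomain g
  · simp [hx, objective_eq_coe hbot hx]
  · simp [hx, objective_eq_top hx]

/-- A feasible point exists by `hdom`, so the objective is not identically `⊤` and a minimizer must
be feasible. -/
theorem isMinimizer_iff (hbot : ∀ y, g y ≠ ⊥) (hdom : (effDomain g ∩ Set.range K).Nonempty)
    {x : X} :
    (∀ z, objective Φ K g b μ x ≤ objective Φ K g b μ z) ↔ K x ∈ effDomain g ∧
      ∀ z, K z ∈ effDomain g → realObjective Φ K g b μ x ≤ realObjective Φ K g b μ z := by
  have hx : (∀ z, objective Φ K g b μ x ≤ objective Φ K g b μ z) → K x ∈ effDomain g := by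
    obtain ⟨_, hy, z, rfl⟩ := hdom
    intro h
    by_contra hx
    have := h z
    rw [objective_eq_top hx, objective_eq_coe hbot hy] at this
    exact EReal.coe_ne_top _ (top_le_iff.1 this)
  constructor
  · intro h
    refine ⟨hx h, fun z => (le_objective_iff hbot).1 ?_⟩
    rw [← objective_eq_coe hbot (hx h)]
    exact h z
  · rintro ⟨hx, h⟩ z
    rw [objective_eq_coe hbot hx]
    exact (le_objective_iff hbot).2 (h z)

theorem norm_map_add_sub_sq (x w : X) :
    ‖Φ (x + w) - b‖ ^ 2 = ‖Φ x - b‖ ^ 2 + 2 * inner ℝ (Φ x - b) (Φ w) + ‖Φ w‖ ^ 2 := by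
  rw [map_add, add_sub_right_comm, norm_add_sq_real]

theorem realObjective_add (hμ : 0 < μ) (x w : X) :
    realObjective Φ K g b μ (x + w) = realObjective Φ K g b μ x +
      1 / μ * inner ℝ (Φ x - b) (Φ w) + 1 / (2 * μ) * ‖Φ w‖ ^ 2 +
      ((g (K x + K w)).toReal - (g (K x)).toReal) := by
  rw [realObjective, realObjective, norm_map_add_sub_sq, map_add]
  field_simp
  ring

/-- Convexity of the objective along segments. -/
theorem realObjective_segment_le (hbot : ∀ y, g y ≠ ⊥) (hconv : IsConvexFun g) (hμ : 0 < μ)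
    {x w : X} (hx : K x ∈ effDomain g) (hw : K (x + w) ∈ effDomain g)
    (hle : realObjective Φ K g b μ (x + w) ≤ realObjective Φ K g b μ x) {t : ℝ} (ht : 0 < t)
    (ht1 : t ≤ 1) :
    K (x + t • w) ∈ effDomain g ∧
      realObjective Φ K g b μ (x + t • w) ≤ realObjective Φ K g b μ x := by
  have h := hconv.slope_mono hbot hx (w := K w)
    (α := (g (K x + K w)).toReal - (g (K x)).toReal) ht ht1
    (by simpa using hw) (by simp)
  rw [map_add, map_smul]
  refine ⟨h.1, ?_⟩
  rw [realObjective_add hμ] at hle ⊢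
  have hn : 0 ≤ 1 / (2 * μ) * ‖Φ w‖ ^ 2 := by positivity
  have e₁ : 1 / (2 * μ) * ‖Φ (t • w)‖ ^ 2 = t ^ 2 * (1 / (2 * μ) * ‖Φ w‖ ^ 2) := by
    rw [map_smul, norm_smul, mul_pow, Real.norm_eq_abs, sq_abs]
    ring
  rw [e₁, map_smul, map_smul, inner_smul_right]
  -- The quadratic term scales by `t ^ 2 ≤ t`, so the whole increment is at most `t` times the
  -- increment at `t = 1`.
  nlinarith [h.2, mul_le_mul_of_nonneg_left ht1 (mul_nonneg ht.le hn),
    mul_le_mul_of_nonneg_left hle ht.le]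

variable [FiniteDimensional ℝ X] [FiniteDimensional ℝ Y] [FiniteDimensional ℝ E]

theorem mem_solutionMap_iff_exists {x : X} :
    x ∈ solutionMap Φ K g b μ ↔ ∃ v ∈ subdifferential g (K x),
      ∀ h, inner ℝ v (K h) = -(1 / μ * inner ℝ (Φ x - b) (Φ h)) := by
  refine exists_congr fun v => and_congr_right fun _ => ?_
  have key : ∀ h, inner ℝ ((1 / μ) • LinearMap.adjoint Φ (Φ x - b) + LinearMap.adjoint K v) h =
      1 / μ * inner ℝ (Φ x - b) (Φ h) + inner ℝ v (K h) := by
    intro h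
    rw [inner_add_left, real_inner_smul_left, LinearMap.adjoint_inner_left,
      LinearMap.adjoint_inner_left]
  constructor
  · intro h₀ h
    have := key h
    rw [h₀, inner_zero_left] at this
    linarith
  · intro h₀
    refine ext_inner_right ℝ fun h => ?_
    rw [key, h₀, inner_zero_left]
    ring

/-- Solutions of the generalized equation are exactly the global minimizers. -/
theorem mem_solutionMap_iff (hbot : ∀ y, g y ≠ ⊥) (hconv : IsConvexFun g)
    (hplq : IsPiecewiseLinearQuadratic g) (hdom : (effDomain g ∩ Set.range K).Nonempty)
    (hμ : 0 < μ) {x : X} :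
    x ∈ solutionMap Φ K g b μ ↔ ∀ z, objective Φ K g b μ x ≤ objective Φ K g b μ z := by
  rw [isMinimizer_iff hbot hdom, mem_solutionMap_iff_exists]
  constructor
  · rintro ⟨v, hv, hvK⟩
    rw [mem_subdifferential_iff hbot] at hv
    refine ⟨hv.1, fun z hz => ?_⟩
    obtain ⟨w, rfl⟩ : ∃ w, z = x + w := ⟨z - x, by abel⟩
    have := hv.2 _ hz
    rw [← map_sub, add_sub_cancel_left, hvK, map_add] at this
    rw [realObjective_add hμ]
    have hn : 0 ≤ 1 / (2 * μ) * ‖Φ w‖ ^ 2 := by positivity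
    linarith
  · rintro ⟨hx, hmin⟩
    -- Minimality along `x + t • h` bounds `g` below by minus the expansion of the smooth term: its
    -- linear part is `p`, its quadratic part the remainder `r`.
    obtain ⟨v, hv, h⟩ := exists_mem_subdifferential_inner_comp_eq hbot hconv hplq hx K
      (-(1 / μ) • (innerₗ E (Φ x - b)).comp Φ) (fun h => 1 / (2 * μ) * ‖Φ h‖ ^ 2) (by
        intro h t ht hm
        have := hmin (x + t • h) (by rwa [map_add, map_smul])
        rw [realObjective_add hμ, map_smul, map_smul, inner_smul_right, norm_smul, mul_pow,
          Real.norm_eq_abs, sq_abs] at this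
        simp only [LinearMap.smul_apply, LinearMap.comp_apply, innerₗ_apply_apply, smul_eq_mul]
        linarith)
    refine ⟨v, hv, fun k => (h k).trans ?_⟩
    simp only [LinearMap.smul_apply, LinearMap.comp_apply, innerₗ_apply_apply, smul_eq_mul,
      neg_mul]

/-! ### Quadratic growth, uniqueness and isolated calmness. -/

/-- Quadratic growth along one linear-quadratic piece. -/
theorem exists_growth_of_piece (hμ : 0 < μ) {C : Set Y} (hC : IsPolyhedral C) {A : Y →ₗ[ℝ] Y}
    {q : Y} {c : ℝ} (hA : A.IsPositive)
    (hg : ∀ y ∈ C, g y = ((1 / 2 * inner ℝ (A y) y + inner ℝ q y + c : ℝ) : EReal))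
    {x : X}
    (hmin : ∀ w, w ≠ 0 → K (x + w) ∈ C →
      realObjective Φ K g b μ x < realObjective Φ K g b μ (x + w)) :
    ∃ m > 0, ∃ ε > 0, ∀ w, ‖w‖ < ε → K (x + w) ∈ C →
      realObjective Φ K g b μ x + m * ‖w‖ ^ 2 ≤ realObjective Φ K g b μ (x + w) := by
  by_cases hx : K x ∈ C
  swap
  -- A closed piece missing `K x` is not met near `x`, so the growth claim is vacuous there.
  · have hcont : Continuous fun w : X => K (x + w) :=
      (LinearMap.continuous_of_finiteDimensional K).comp (by fun_prop)
    have : ∀ᶠ w in 𝓝 (0 : X), K (x + w) ∈ Cᶜ :=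
      hcont.continuousAt.eventually_mem (hC.isClosed.isOpen_compl.mem_nhds (by simpa using hx))
    obtain ⟨ε, hε, h⟩ := Metric.eventually_nhds_iff.1 this
    exact ⟨1, one_pos, ε, hε, fun w hw hm => absurd hm (h (by simpa using hw))⟩
  obtain ⟨s, hs, δ, hδ, hsδ⟩ := hC.exists_tangentCone hx
  let d : X → ℝ := fun w => 1 / μ * inner ℝ (Φ x - b) (Φ w) + inner ℝ (A (K x) + q) (K w)
  let B : X → ℝ := fun w => 1 / (2 * μ) * ‖Φ w‖ ^ 2 + 1 / 2 * inner ℝ (A (K w)) (K w)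
  have hexp : ∀ w, K (x + w) ∈ C →
      realObjective Φ K g b μ (x + w) = realObjective Φ K g b μ x + d w + B w := by
    intro w hw
    rw [realObjective_add hμ, toReal_add_eq hA hg hx (by rwa [← map_add])]
    simp only [d, B]
    ring
  have hd : ∀ (t : ℝ) w, d (t • w) = t * d w := by
    intro t w
    simp only [d, map_smul, inner_smul_right]
    ring
  have hB : ∀ (t : ℝ) w, B (t • w) = t ^ 2 * B w := by
    intro t w
    simp only [B, map_smul, inner_smul_right, real_inner_smul_left, norm_smul, mul_pow,
      Real.norm_eq_abs, sq_abs]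
    ring
  have hB0 : ∀ w, 0 ≤ B w := by
    intro w
    have : 0 ≤ inner ℝ (A (K w)) (K w) := hA.re_inner_nonneg_left _
    have h2 : 0 ≤ 1 / (2 * μ) * ‖Φ w‖ ^ 2 := by positivity
    simp only [B]
    linarith
  have hΦc := LinearMap.continuous_of_finiteDimensional Φ
  have hKc := LinearMap.continuous_of_finiteDimensional K
  have hAc := LinearMap.continuous_of_finiteDimensional A
  let T : Set X := {w | ∀ f ∈ s, f (K w) ≤ 0}
  have hT : IsClosed T := by
    simp only [T, Set.ofPred_forall]
    exact isClosed_biInter fun f _ => isClosed_le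
      ((LinearMap.continuous_of_finiteDimensional f).comp hKc) continuous_const
  have hTsmul : ∀ w ∈ T, ∀ t : ℝ, 0 < t → t * ‖K w‖ ≤ δ → K (x + t • w) ∈ C := by
    intro w hw t ht htδ
    rw [map_add, map_smul]
    refine hsδ _ (fun f hf => ?_) (by rwa [norm_smul, Real.norm_of_nonneg ht.le])
    rw [map_smul, smul_eq_mul]
    exact mul_nonpos_of_nonneg_of_nonpos ht.le (hw f hf)
  -- Strict minimality divided by `t` reads `0 < d w + t * B w` for small `t`. Hence `d w ≥ 0`, and
  -- if `d w = 0` then `B w > 0`.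
  have hpos : ∀ w ∈ T, w ≠ 0 → 0 ≤ d w ∧ 0 < d w + B w := by
    intro w hw hw0
    have key : ∀ t, 0 < t → t ≤ δ / (‖K w‖ + 1) → 0 < d w + t * B w := by
      intro t ht htδ
      rw [le_div_iff₀ (by positivity)] at htδ
      have hm := hTsmul w hw t ht (by linarith)
      have := hmin _ (smul_ne_zero ht.ne' hw0) hm
      rw [hexp _ hm, hd, hB] at this
      refine (mul_pos_iff_of_pos_left ht).1 ?_
      linarith
    have h₁ := nonneg_of_forall_small (δ := δ / (‖K w‖ + 1)) (by positivity)
      fun t ht htδ => (key t ht htδ).le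
    refine ⟨h₁, ?_⟩
    have h₂ := key (δ / (‖K w‖ + 1)) (by positivity) le_rfl
    rcases h₁.eq_or_lt with h | h
    · rw [← h, zero_add] at h₂ ⊢
      exact (mul_pos_iff_of_pos_left (by positivity)).1 h₂
    · linarith [hB0 w]
  obtain ⟨m, hm, hmle⟩ := exists_pos_le_of_compact (f := fun w => d w + B w)
    ((isCompact_sphere (0 : X) 1).inter_right hT) (by fun_prop)
    (fun w hw => (hpos w hw.2 (Metric.ne_of_mem_sphere hw.1 one_ne_zero)).2)
  -- The expansion is exact on the whole piece; radius 1 only serves to give `‖w‖ * d w ≤ d w` after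
  -- rescaling from the sphere.
  refine ⟨m, hm, 1, one_pos, fun w hw hwC => ?_⟩
  rw [hexp w hwC]
  rcases eq_or_ne w 0 with rfl | hw0
  · simp [d, B]
  have hn : 0 < ‖w‖ := norm_pos_iff.2 hw0
  have hwT : w ∈ T := hs _ (by rwa [← map_add])
  have huT : ‖w‖⁻¹ • w ∈ T := by
    intro f hf
    rw [map_smul, map_smul, smul_eq_mul]
    exact mul_nonpos_of_nonneg_of_nonpos (by positivity) (hwT f hf)
  have h := hmle _ ⟨by simp [norm_smul, hn.ne'], huT⟩
  simp only [hd, hB] at h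
  have h' := mul_le_mul_of_nonneg_left h (sq_nonneg ‖w‖)
  have e : ‖w‖ ^ 2 * (‖w‖⁻¹ * d w + ‖w‖⁻¹ ^ 2 * B w) = ‖w‖ * d w + B w := by
    field_simp
  rw [e] at h'
  nlinarith [mul_le_mul_of_nonneg_right hw.le (hpos w hwT hw0).1]

/-- Growth holds on each piece, and finitely many pieces allow the smallest constant and the
smallest radius. -/
theorem IsUniqueMinimizer.isStrongMinimizer (hbot : ∀ y, g y ≠ ⊥)
    (hplq : IsPiecewiseLinearQuadratic g) (hdom : (effDomain g ∩ Set.range K).Nonempty)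
    (hμ : 0 < μ) {x : X} (h : IsUniqueMinimizer (objective Φ K g b μ) x) :
    IsStrongMinimizer (objective Φ K g b μ) x := by
  obtain ⟨hx, hmin⟩ := (isMinimizer_iff hbot hdom).1 ((h x).2 rfl)
  have hlt : ∀ w, w ≠ 0 → K (x + w) ∈ effDomain g →
      realObjective Φ K g b μ x < realObjective Φ K g b μ (x + w) := by
    intro w hw hm
    by_contra! hle
    have : x + w = x := (h _).1 ((isMinimizer_iff hbot hdom).2
      ⟨hm, fun z hz => hle.trans (hmin z hz)⟩)
    exact hw (by simpa using this)
  obtain ⟨N, C, hC, hCdom, hquad⟩ := hplq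
  have hsub : ∀ i, C i ⊆ effDomain g := fun i => hCdom ▸ Set.subset_iUnion C i
  have hpiece : ∀ i, ∃ m > 0, ∃ ε > 0, ∀ w, ‖w‖ < ε → K (x + w) ∈ C i →
      realObjective Φ K g b μ x + m * ‖w‖ ^ 2 ≤ realObjective Φ K g b μ (x + w) := by
    intro i
    obtain ⟨A, q, c, hA, hg⟩ := hquad i
    exact exists_growth_of_piece hμ (hC i) hA hg fun w hw hm => hlt w hw (hsub i hm)
  choose m hm ε hε hgrow using hpiece
  obtain ⟨i₀, -⟩ : ∃ i, K x ∈ C i := by rwa [hCdom, Set.mem_iUnion] at hx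
  have : Nonempty (Fin N) := ⟨i₀⟩
  obtain ⟨i, hi⟩ := Finite.exists_min m
  obtain ⟨j, hj⟩ := Finite.exists_min ε
  refine ⟨?_, ?_, 2 * m i, by have := hm i; positivity, ε j, hε j, fun z hz => ?_⟩
  · rw [objective_eq_coe hbot hx]; exact EReal.coe_ne_top _
  · rw [objective_eq_coe hbot hx]; exact EReal.coe_ne_bot _
  rw [objective_eq_coe hbot hx, ← EReal.coe_add, le_objective_iff hbot]
  intro hzdom
  obtain ⟨w, rfl⟩ : ∃ w, z = x + w := ⟨z - x, by abel⟩
  obtain ⟨k, hk⟩ : ∃ k, K (x + w) ∈ C k := by rwa [hCdom, Set.mem_iUnion] at hzdom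
  have hw : ‖w‖ < ε j := by simpa using hz
  have := hgrow k w (hw.trans_le (hj k)) hk
  rw [add_sub_cancel_left]
  nlinarith [mul_le_mul_of_nonneg_right (hi k) (sq_nonneg ‖w‖)]

theorem IsStrongMinimizer.exists_growth (hbot : ∀ y, g y ≠ ⊥) {x : X}
    (h : IsStrongMinimizer (objective Φ K g b μ) x) :
    K x ∈ effDomain g ∧ ∃ c > 0, ∃ ε > 0, ∀ w, ‖w‖ < ε → K (x + w) ∈ effDomain g →
      realObjective Φ K g b μ x + c * ‖w‖ ^ 2 ≤ realObjective Φ K g b μ (x + w) := by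
  obtain ⟨htop, -, c, hc, ε, hε, hgrow⟩ := h
  have hx : K x ∈ effDomain g := fun hx => htop (objective_eq_top (not_not.2 hx))
  refine ⟨hx, c / 2, half_pos hc, ε, hε, fun w hw hm => ?_⟩
  have := hgrow (x + w) (by simpa using hw)
  rw [objective_eq_coe hbot hx, ← EReal.coe_add, le_objective_iff hbot,
    add_sub_cancel_left] at this
  exact this hm

/-- A competitor no worse than `x` makes every point of the segment no worse, including points
inside the growth ball, where growth forbids it. -/
theorem IsStrongMinimizer.isUniqueMinimizer (hbot : ∀ y, g y ≠ ⊥) (hconv : IsConvexFun g)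
    (hdom : (effDomain g ∩ Set.range K).Nonempty)
    (hμ : 0 < μ) {x : X} (h : IsStrongMinimizer (objective Φ K g b μ) x) :
    IsUniqueMinimizer (objective Φ K g b μ) x := by
  obtain ⟨hx, c, hc, ε, hε, hgrow⟩ := h.exists_growth hbot
  have key : ∀ z, K z ∈ effDomain g →
      realObjective Φ K g b μ z ≤ realObjective Φ K g b μ x → z = x := by
    intro z hz hle
    obtain ⟨w, rfl⟩ : ∃ w, z = x + w := ⟨z - x, by abel⟩
    by_contra hne
    have hw : 0 < ‖w‖ := norm_pos_iff.2 fun h0 => hne (by simp [h0])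
    have ht : 0 < min 1 (ε / 2 / ‖w‖) := lt_min one_pos (by positivity)
    obtain ⟨h₁, h₂⟩ := realObjective_segment_le hbot hconv hμ hx hz hle ht (min_le_left _ _)
    have ht' : min 1 (ε / 2 / ‖w‖) * ‖w‖ ≤ ε / 2 := by
      rw [← le_div_iff₀ hw]; exact min_le_right _ _
    set t := min 1 (ε / 2 / ‖w‖)
    have hn : ‖t • w‖ = t * ‖w‖ := by rw [norm_smul, Real.norm_of_nonneg ht.le]
    have := hgrow (t • w) (by rw [hn]; linarith) h₁
    have hp : 0 < c * ‖t • w‖ ^ 2 := by rw [hn]; positivity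
    linarith
  intro z
  rw [isMinimizer_iff hbot hdom]
  constructor
  · rintro ⟨hz, hmin⟩
    exact key z hz (hmin x hx)
  · rintro rfl
    refine ⟨hx, fun y hy => ?_⟩
    by_contra! hlt
    rw [key y hy hlt.le] at hlt
    exact lt_irrefl _ hlt

/-- Quadratic growth gives Lipschitz stability of all nearby solutions. -/
theorem IsStrongMinimizer.isIsolatedCalm (hbot : ∀ y, g y ≠ ⊥) {bbar : E} {μbar : ℝ}
    (hμ : 0 < μbar) {x : X} (hmem : x ∈ solutionMap Φ K g bbar μbar)
    (h : IsStrongMinimizer (objective Φ K g bbar μbar) x) :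
    IsIsolatedCalm (solutionMap Φ K g) bbar μbar x := by
  obtain ⟨hx, c, hc, ε, hε, hgrow⟩ := h.exists_growth hbot
  let Φ' : X →L[ℝ] E := LinearMap.toContinuousLinearMap Φ
  have hΦ' : ∀ w, ‖Φ w‖ ≤ ‖Φ'‖ * ‖w‖ := fun w => Φ'.le_opNorm w
  set L := ‖Φ'‖
  have hL : 0 ≤ L := norm_nonneg _
  -- `R` bounds the residual over the growth ball. Keeping `μ > μbar / 2` gives `1 / μ ≤ 2 / μbar`;
  -- the `+ 1` in `κ` keeps it positive when `L = 0`.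
  let R : ℝ := ‖Φ x - bbar‖ + L * ε
  have hR : 0 ≤ R := by positivity
  let κ : ℝ := L * (2 / μbar + 2 / μbar ^ 2 * R) / c + 1
  refine ⟨hmem, Metric.ball x ε, Metric.ball_mem_nhds x hε, Set.univ, Filter.univ_mem,
    Set.Ioi (μbar / 2), Ioi_mem_nhds (half_lt_self hμ), ?_, κ, by positivity, ?_⟩
  · exact Set.Ioi_subset_Ioi (half_pos hμ).le
  rintro b - μ hμ2 z ⟨hz, hzε⟩
  have hμ2 : μbar / 2 < μ := hμ2
  have hμ0 : 0 < μ := (half_pos hμ).trans hμ2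
  obtain ⟨v, hv, hvK⟩ := mem_solutionMap_iff_exists.1 hz
  rw [mem_subdifferential_iff hbot] at hv
  obtain ⟨w, rfl⟩ : ∃ w, z = x + w := ⟨z - x, by abel⟩
  have hw : ‖w‖ < ε := by simpa using hzε
  have h₁ := hv.2 _ hx
  rw [← map_sub, sub_add_cancel_left, hvK, map_neg, inner_neg_right] at h₁
  have h₂ := hgrow w hw hv.1
  rw [realObjective_add hμ] at h₂
  rw [map_add K x w] at h₁
  have hdecomp : Φ (x + w) - b = (Φ (x + w) - bbar) - (b - bbar) := by abel
  have hsplit : inner ℝ (Φ (x + w) - bbar) (Φ w) =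
      inner ℝ (Φ x - bbar) (Φ w) + ‖Φ w‖ ^ 2 := by
    rw [map_add, add_sub_right_comm, inner_add_left, real_inner_self_eq_norm_sq]
  rw [hdecomp, inner_sub_left] at h₁
  set a := inner ℝ (Φ (x + w) - bbar) (Φ w) with ha
  have hn : 1 / (2 * μbar) * ‖Φ w‖ ^ 2 ≤ 1 / μbar * ‖Φ w‖ ^ 2 := by
    gcongr
    linarith
  -- Adding growth at `z` to the subgradient inequality from `z` to `x` cancels the values of `g`.
  -- Only parameter differences remain, each multiplied by a term of order `‖w‖`, so one factor
  -- `‖w‖` can be divided out.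
  have h₃ : c * ‖w‖ ^ 2 ≤ (1 / μbar - 1 / μ) * a + 1 / μ * inner ℝ (b - bbar) (Φ w) := by
    have e : 1 / μbar * a =
        1 / μbar * inner ℝ (Φ x - bbar) (Φ w) + 1 / μbar * ‖Φ w‖ ^ 2 := by
      rw [hsplit]; ring
    linarith
  have hinv : 1 / μ ≤ 2 / μbar := by
    rw [div_le_div_iff₀ hμ0 hμ]; linarith
  have hres : ‖Φ (x + w) - bbar‖ ≤ R := by
    rw [map_add, add_sub_right_comm]
    refine (norm_add_le _ _).trans ?_
    have := mul_le_mul_of_nonneg_left hw.le hL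
    linarith [hΦ' w]
  have hdiff : |1 / μbar - 1 / μ| ≤ 2 / μbar ^ 2 * |μ - μbar| := by
    have e : 1 / μbar - 1 / μ = 1 / μ * (1 / μbar) * (μ - μbar) := by field_simp
    rw [e, abs_mul, abs_of_pos (by positivity)]
    refine mul_le_mul_of_nonneg_right ?_ (abs_nonneg _)
    calc 1 / μ * (1 / μbar) ≤ 2 / μbar * (1 / μbar) := by gcongr
      _ = 2 / μbar ^ 2 := by ring
  have ha' : |a| ≤ R * (L * ‖w‖) := (abs_real_inner_le_norm _ _).trans
    (mul_le_mul hres (hΦ' w) (norm_nonneg _) hR)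
  have h₄ : (1 / μbar - 1 / μ) * a ≤ 2 / μbar ^ 2 * |μ - μbar| * (R * (L * ‖w‖)) := by
    refine (le_abs_self _).trans ?_
    rw [abs_mul]
    exact mul_le_mul hdiff ha' (abs_nonneg _) (by positivity)
  have h₅ : 1 / μ * inner ℝ (b - bbar) (Φ w) ≤ 2 / μbar * (‖b - bbar‖ * (L * ‖w‖)) := by
    have : inner ℝ (b - bbar) (Φ w) ≤ ‖b - bbar‖ * (L * ‖w‖) :=
      (real_inner_le_norm _ _).trans (mul_le_mul_of_nonneg_left (hΦ' w) (norm_nonneg _))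
    calc 1 / μ * inner ℝ (b - bbar) (Φ w) ≤ 1 / μ * (‖b - bbar‖ * (L * ‖w‖)) := by gcongr
      _ ≤ _ := by gcongr
  rw [add_sub_cancel_left]
  rcases (norm_nonneg w).eq_or_lt with h0 | hwpos
  · rw [← h0]; positivity
  have h₆ : c * ‖w‖ ≤ L * (2 / μbar * ‖b - bbar‖ + 2 / μbar ^ 2 * R * |μ - μbar|) := by
    refine le_of_mul_le_mul_right ?_ hwpos
    linarith
  have h₇ : 2 / μbar * ‖b - bbar‖ + 2 / μbar ^ 2 * R * |μ - μbar| ≤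
      (2 / μbar + 2 / μbar ^ 2 * R) * (‖b - bbar‖ + |μ - μbar|) := by
    have p₁ : 0 ≤ 2 / μbar * |μ - μbar| := by positivity
    have p₂ : 0 ≤ 2 / μbar ^ 2 * R * ‖b - bbar‖ := by positivity
    linarith
  have h₈ : ‖w‖ ≤ L * (2 / μbar + 2 / μbar ^ 2 * R) / c * (‖b - bbar‖ + |μ - μbar|) := by
    rw [div_mul_eq_mul_div, le_div_iff₀ hc]
    have := mul_le_mul_of_nonneg_left h₇ hL
    linarith
  have p : 0 ≤ ‖b - bbar‖ + |μ - μbar| := by positivity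
  calc ‖w‖ ≤ _ := h₈
    _ ≤ κ * (‖b - bbar‖ + |μ - μbar|) := by
      refine mul_le_mul_of_nonneg_right ?_ p
      simp only [κ]
      linarith

/-- At the reference parameters the calmness bound is zero, so no other solution lies in `U`. Yet a
second solution would put points of the segment to it, all solutions, arbitrarily near `x`. -/
theorem IsIsolatedCalm.solutionMap_eq (hbot : ∀ y, g y ≠ ⊥) (hconv : IsConvexFun g)
    (hplq : IsPiecewiseLinearQuadratic g) (hdom : (effDomain g ∩ Set.range K).Nonempty)
    (hμ : 0 < μ) {x : X} (h : IsIsolatedCalm (solutionMap Φ K g) b μ x) :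
    solutionMap Φ K g b μ = {x} := by
  obtain ⟨hmem, U, hU, V, hV, W, hW, -, κ, -, hκ⟩ := h
  refine Set.eq_singleton_iff_unique_mem.2 ⟨hmem, fun z hz => ?_⟩
  rw [mem_solutionMap_iff hbot hconv hplq hdom hμ, isMinimizer_iff hbot hdom] at hmem hz
  obtain ⟨w, rfl⟩ : ∃ w, z = x + w := ⟨z - x, by abel⟩
  have hlim : Filter.Tendsto (fun t : ℝ => x + t • w) (𝓝[>] 0) (𝓝 x) := by
    have : Continuous fun t : ℝ => x + t • w := by fun_prop
    simpa using (this.tendsto 0).mono_left nhdsWithin_le_nhds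
  obtain ⟨t, htU, ht⟩ := ((hlim.eventually_mem hU).and (Ioc_mem_nhdsGT one_pos)).exists
  obtain ⟨h₁, h₂⟩ := realObjective_segment_le hbot hconv hμ hmem.1 hz.1 (hz.2 x hmem.1)
    ht.1 ht.2
  have hsol : x + t • w ∈ solutionMap Φ K g b μ := by
    rw [mem_solutionMap_iff hbot hconv hplq hdom hμ, isMinimizer_iff hbot hdom]
    exact ⟨h₁, fun y hy => h₂.trans (hmem.2 y hy)⟩
  have := hκ b (mem_of_mem_nhds hV) μ (mem_of_mem_nhds hW) _ ⟨hsol, htU⟩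
  rw [add_sub_cancel_left, sub_self, sub_self, norm_zero, abs_zero, add_zero, mul_zero,
    norm_le_zero_iff, smul_eq_zero] at this
  rw [this.resolve_left ht.1.ne', add_zero]

theorem isUniqueMinimizer_iff_solutionMap_eq (hbot : ∀ y, g y ≠ ⊥) (hconv : IsConvexFun g)
    (hplq : IsPiecewiseLinearQuadratic g) (hdom : (effDomain g ∩ Set.range K).Nonempty)
    (hμ : 0 < μ) {x : X} :
    IsUniqueMinimizer (objective Φ K g b μ) x ↔ solutionMap Φ K g b μ = {x} := by
  rw [Set.ext_iff]
  refine forall_congr' fun z => ?_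
  rw [mem_solutionMap_iff hbot hconv hplq hdom hμ, Set.mem_singleton_iff]

end Problem

end RegLS

theorem corollary4p6
    {X Y E : Type*}
    [NormedAddCommGroup X] [InnerProductSpace ℝ X] [FiniteDimensional ℝ X]
    [NormedAddCommGroup Y] [InnerProductSpace ℝ Y] [FiniteDimensional ℝ Y]
    [NormedAddCommGroup E] [InnerProductSpace ℝ E] [FiniteDimensional ℝ E]
    (Φ : X →ₗ[ℝ] E) (K : X →ₗ[ℝ] Y) (g : Y → EReal)
    (hbot : ∀ y, g y ≠ ⊥) (hlsc : LowerSemicontinuous g) (hconv : RegLS.IsConvexFun g)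
    (hplq : RegLS.IsPiecewiseLinearQuadratic g)
    (hdom : (RegLS.effDomain g ∩ Set.range K).Nonempty)
    (bbar : E) (μbar : ℝ) (hμ : 0 < μbar) (xbar : X) :
    List.TFAE [
      RegLS.IsIsolatedCalm (RegLS.solutionMap Φ K g) bbar μbar xbar,
      RegLS.solutionMap Φ K g bbar μbar = {xbar},
      RegLS.IsUniqueMinimizer (RegLS.objective Φ K g bbar μbar) xbar,
      RegLS.IsStrongMinimizer (RegLS.objective Φ K g bbar μbar) xbar] := by
  have huniq := RegLS.isUniqueMinimizer_iff_solutionMap_eq (Φ := Φ) (b := bbar) (x := xbar)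
    hbot hconv hplq hdom hμ
  tfae_have 1 → 2 := fun h => h.solutionMap_eq hbot hconv hplq hdom hμ
  tfae_have 2 → 3 := huniq.2
  tfae_have 3 → 4 := fun h => h.isStrongMinimizer hbot hplq hdom hμ
  tfae_have 4 → 1 := fun h => by
    refine h.isIsolatedCalm hbot hμ ?_
    rw [huniq.1 (h.isUniqueMinimizer hbot hconv hdom hμ)]
    rfl
  tfae_finish
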